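/- For a compact Hausdorff space $K$ let $C(K)$ be the Banach space of continuous real-valued functions on $K$ with the maximum norm. A linear isometry (into) $T\colon X\to Y$ between real Banach spaces is called a U-embedding if for every $x^*\in X^*$ with $\|x^*\|=1$ there is exactly one $y^*\in Y^*$ with $y^*\circ T=x^*$ and $\|y^*\|=\|x^*\|$. If $h\colon K\to S$ is a topological embedding between compact Hausdorff spaces, a bounded linear operator $T\colon C(K)\to C(S)$ is called a linear extension operator for $h$ if $(Tf)(h(k))=f(k)$ for all $f\in C(K)$ and $k\in K$. **Theorem.** Let $K$ and $S$ be compact Hausdorff spaces with $K$ nonempty. The following conditions are equivalent: 1. There exists a U-embedding $T\colon C(K)\to C(S)$. 2. There exists a topological embedding (homeomorphism onto its image) $h\colon K\to S$ such that $h(K)$ is a $G_\delta$ subset of $S$ and $h$ admits a linear extension operator $T\colon C(K)\to C(S)$ with $\|T\|=1$. -/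

import Mathlib

open Topology

/-- `y'` is a Hahn–Banach extension of `x'` through the linear isometry `T : X → Y`:
`T^* y' = x'` and `‖y'‖ = ‖x'‖`. -/
def IsHahnBanachExtension {X Y : Type*} [NormedAddCommGroup X] [NormedSpace ℝ X]
    [NormedAddCommGroup Y] [NormedSpace ℝ Y] (T : X →ₗᵢ[ℝ] Y)
    (x' : StrongDual ℝ X) (y' : StrongDual ℝ Y) : Prop :=
  y'.comp T.toContinuousLinearMap = x' ∧ ‖y'‖ = ‖x'‖

/-- A linear isometry `T` from `X` into `Y` is a U-embedding if every functional in the unit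
sphere of the dual of `X` has a unique Hahn–Banach extension through `T`. -/
def IsUEmbedding {X Y : Type*} [NormedAddCommGroup X] [NormedSpace ℝ X]
    [NormedAddCommGroup Y] [NormedSpace ℝ Y] (T : X →ₗᵢ[ℝ] Y) : Prop :=
  ∀ x' : StrongDual ℝ X, ‖x'‖ = 1 → ∃! y' : StrongDual ℝ Y, IsHahnBanachExtension T x' y'

/-- The Dirac functional `δ_k : f ↦ f k` on `C(K)`. -/
noncomputable def diracFunctional {K : Type*} [TopologicalSpace K] [CompactSpace K] (k : K) :
    StrongDual ℝ C(K, ℝ) :=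
  ContinuousMap.evalCLM ℝ k

/-- The map `F_T = T^* ∘ δ : S → X^*` associated with an operator `T : X → C(S)`. -/
noncomputable def associatedMap {X S : Type*} [NormedAddCommGroup X] [NormedSpace ℝ X]
    [TopologicalSpace S] [CompactSpace S] (T : X →L[ℝ] C(S, ℝ)) (s : S) : StrongDual ℝ X :=
  (diracFunctional s).comp T

/-- `T : C(K) → C(S)` is a linear extension operator for `h : K → S` if `F_T ∘ h = δ`, that is,
`T f (h k) = f k` for all `f` and `k`. -/
def IsLinearExtensionOperator {K S : Type*} [TopologicalSpace K] [CompactSpace K]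
    [TopologicalSpace S] [CompactSpace S] (h : K → S) (T : C(K, ℝ) →L[ℝ] C(S, ℝ)) : Prop :=
  associatedMap T ∘ h = diracFunctional

/-!
If `f` is largest in modulus at `k` with `f k ≥ 0`, then `T f` attains `‖f‖` in modulus somewhere;
for finitely many such functions this happens at a common point, because their sum is again of this
kind. By compactness of `S` (Holsztyński's argument) every Dirac functional `δ_k` is therefore, up
to sign, of the form `δ_s ∘ T`. If `T` is a U-embedding, uniqueness of Hahn–Banach extensions makes
`s = h k` unique, and `h` is continuous because its graph is closed. Moreover `δ_s ∘ T` has norm one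
exactly for `s ∈ h(K)`: at any other such `s` it would have two Hahn–Banach extensions, `δ_s` and
one carried by `h(K)`. Lower semicontinuity of `s ↦ ‖δ_s ∘ T‖` then shows that `h(K)` is a `Gδ`.

Conversely, let `E` be a norm-one extension operator and `0 ≤ g ≤ 1` a continuous function on `S`
equal to one exactly on `h(K)`. Put `T = g * E`. For `‖f‖, ‖w‖ ≤ 1` the function `T f ± w * (1 - g)`
still has norm at most one, so every Hahn–Banach extension through `T` kills the ideal generated by
`1 - g`, hence every function vanishing on `h(K)`.
-/

section Topology

variable {X Y : Type*} [TopologicalSpace X] [TopologicalSpace Y]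

theorem continuous_of_isClosed_graph [CompactSpace Y] {f : X → Y}
    (hf : IsClosed {p : X × Y | p.2 = f p.1}) : Continuous f := by
  refine continuous_iff_isClosed.2 fun C hC => ?_
  have hproj : f ⁻¹' C = Prod.fst '' ({p : X × Y | p.2 = f p.1} ∩ Prod.snd ⁻¹' C) := by
    ext x
    simp
  rw [hproj]
  exact isClosedMap_fst_of_compactSpace _ (hf.inter (hC.preimage continuous_snd))

theorem isGδ_le_of_lowerSemicontinuous {β : Type*} [LinearOrder β] [DenselyOrdered β]
    [NoMinOrder β] [TopologicalSpace β] [OrderTopology β] [FirstCountableTopology β] {f : X → β}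
    (hf : LowerSemicontinuous f) (c : β) : IsGδ {x | c ≤ f x} := by
  obtain ⟨u, -, hu_lt, hu_lim⟩ := exists_seq_strictMono_tendsto c
  have hinter : {x | c ≤ f x} = ⋂ n, f ⁻¹' Set.Ioi (u n) := by
    ext x
    simp only [Set.mem_ofPred_eq, Set.mem_iInter, Set.mem_preimage, Set.mem_Ioi]
    exact ⟨fun hx n => (hu_lt n).trans_le hx, fun hx => le_of_tendsto' hu_lim fun n => (hx n).le⟩
  rw [hinter]
  exact .iInter_of_isOpen fun n => hf.isOpen_preimage (u n)

theorem mem_of_forall_continuousMap_eq_zero [CompletelyRegularSpace X] {A : Set X}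
    (hA : IsClosed A) {x : X} (hx : ∀ u : C(X, ℝ), (∀ a ∈ A, u a = 0) → u x = 0) : x ∈ A := by
  by_contra hxA
  obtain ⟨u, hu, hux, huA⟩ := CompletelyRegularSpace.completely_regular x A hA hxA
  have h := hx ⟨fun y => 1 - u y, by fun_prop⟩ fun a ha => by simp [huA ha]
  simp [hux] at h

end Topology

section NormedSpaces

theorem lowerSemicontinuous_opNorm {A 𝕜 E F : Type*} [TopologicalSpace A]
    [DenselyNormedField 𝕜] [NormedAddCommGroup E] [NormedSpace 𝕜 E] [SeminormedAddCommGroup F]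
    [NormedSpace 𝕜 F] {φ : A → E →L[𝕜] F} (hφ : ∀ v, Continuous fun a => φ a v) :
    LowerSemicontinuous fun a => ‖φ a‖ := by
  intro a r hr
  obtain ⟨v, hv, hrv⟩ := (φ a).exists_lt_apply_of_lt_opNorm hr
  filter_upwards [(hφ v).norm.continuousAt.eventually_const_lt hrv] with b hb
  exact hb.trans_le ((φ b).unit_le_opNorm v hv.le)

variable {X Y : Type*} [NormedAddCommGroup X] [NormedSpace ℝ X]
  [NormedAddCommGroup Y] [NormedSpace ℝ Y]

/-- A contraction with a contractive left inverse, as a linear isometry. -/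
def isometryOfLeftInverse (T : X →L[ℝ] Y) (R : Y →L[ℝ] X) (hT : ‖T‖ ≤ 1) (hR : ‖R‖ ≤ 1)
    (hRT : Function.LeftInverse R T) : X →ₗᵢ[ℝ] Y where
  toLinearMap := T
  norm_map' x := by
    refine le_antisymm (by simpa using T.le_of_opNorm_le hT x) ?_
    simpa [hRT x] using R.le_of_opNorm_le hR (T x)

variable {T : X →ₗᵢ[ℝ] Y} {x' : StrongDual ℝ X} {y' : StrongDual ℝ Y} {R : Y →L[ℝ] X}

theorem isHahnBanachExtension_of_norm_le (hT : ∀ x, y' (T x) = x' x) (hle : ‖y'‖ ≤ ‖x'‖) :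
    IsHahnBanachExtension T x' y' := by
  refine ⟨ContinuousLinearMap.ext hT, le_antisymm hle ?_⟩
  refine x'.opNorm_le_bound (norm_nonneg _) fun x => ?_
  rw [← hT x, ← T.norm_map x]
  exact y'.le_opNorm _

theorem isHahnBanachExtension_comp_of_leftInverse (hR : ‖R‖ ≤ 1)
    (hRT : Function.LeftInverse R T) (x' : StrongDual ℝ X) :
    IsHahnBanachExtension T x' (x'.comp R) :=
  isHahnBanachExtension_of_norm_le (fun x => congrArg x' (hRT x))
    ((x'.opNorm_comp_le R).trans (mul_le_of_le_one_right (norm_nonneg _) hR))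

theorem IsUEmbedding.eq_comp_of_leftInverse (hT : IsUEmbedding T) (hR : ‖R‖ ≤ 1)
    (hRT : Function.LeftInverse R T) (hx' : ‖x'‖ = 1) (hy' : IsHahnBanachExtension T x' y') :
    y' = x'.comp R :=
  (hT x' hx').unique hy' (isHahnBanachExtension_comp_of_leftInverse hR hRT x')

theorem isUEmbedding_of_leftInverse (hR : ‖R‖ ≤ 1) (hRT : Function.LeftInverse R T)
    (hker : ∀ x' y', IsHahnBanachExtension T x' y' → ∀ y, R y = 0 → y' y = 0) :
    IsUEmbedding T := by
  refine fun x' _ => ⟨x'.comp R, isHahnBanachExtension_comp_of_leftInverse hR hRT x',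
    fun y' hy' => ContinuousLinearMap.ext fun y => ?_⟩
  have hy : y' (y - T (R y)) = 0 := hker x' y' hy' _ (by rw [map_sub, hRT, sub_self])
  rw [map_sub, sub_eq_zero] at hy
  exact hy.trans (DFunLike.congr_fun hy'.1 (R y))

theorem IsHahnBanachExtension.apply_eq_zero_of_norm_add_le (hy' : IsHahnBanachExtension T x' y')
    {v : Y} (hv : ∀ x, ‖x‖ ≤ 1 → ‖T x + v‖ ≤ 1) : y' v = 0 := by
  have apply_nonpos : ∀ w, (∀ x, ‖x‖ ≤ 1 → ‖T x + w‖ ≤ 1) → y' w ≤ 0 := by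
    intro w hw
    have hadd : ∀ x, ‖x‖ ≤ 1 → x' x + y' w ≤ ‖x'‖ := fun x hx => by
      rw [← hy'.1, ContinuousLinearMap.comp_apply, ← map_add, hy'.1, ← hy'.2]
      exact (le_abs_self _).trans (y'.unit_le_opNorm _ (hw x hx))
    have hnorm : ‖x'‖ ≤ ‖x'‖ - y' w := by
      refine ContinuousLinearMap.opNorm_le_of_unit_norm ?_ fun x hx => abs_le'.2 ⟨?_, ?_⟩
      · simpa using hadd 0 (by simp)
      · linarith [hadd x hx.le]
      · linarith [hadd (-x) (by rw [norm_neg, hx]), map_neg x' x]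
    linarith
  refine le_antisymm (apply_nonpos v hv) ?_
  have hneg := apply_nonpos (-v) fun x hx => by
    rw [← norm_neg, neg_add, neg_neg, ← map_neg]
    exact hv (-x) (by rwa [norm_neg])
  rwa [map_neg, neg_nonpos] at hneg

end NormedSpaces

section ContinuousFunctions

variable {K S : Type*} [TopologicalSpace K] [CompactSpace K] [TopologicalSpace S] [CompactSpace S]

theorem norm_compCLM_le (h : C(K, S)) : ‖ContinuousMap.compCLM ℝ ℝ h‖ ≤ 1 := by
  refine ContinuousLinearMap.opNorm_le_bound _ zero_le_one fun u => ?_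
  rw [one_mul]
  exact (ContinuousMap.norm_le _ (norm_nonneg _)).2 fun k => u.norm_coe_le_norm (h k)

theorem exists_norm_le_norm_apply {E : Type*} [NormedAddCommGroup E] [Nonempty S] (f : C(S, E)) :
    ∃ s, ‖f‖ ≤ ‖f s‖ := by
  by_contra! hlt
  exact lt_irrefl ‖f‖ (f.norm_lt_iff_of_nonempty.2 hlt)

theorem norm_diracFunctional (k : K) : ‖diracFunctional k‖ = 1 := by
  have : Nonempty K := ⟨k⟩
  refine ContinuousLinearMap.opNorm_eq_of_bounds zero_le_one (fun f => ?_) fun C _ hC => ?_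
  · rw [one_mul]
    exact f.norm_coe_le_norm k
  · simpa [diracFunctional] using hC 1

theorem diracFunctional_injective [T2Space K] :
    Function.Injective (diracFunctional : K → StrongDual ℝ C(K, ℝ)) := fun _ _ h =>
  (WeakDual.CharacterSpace.continuousMapEval_bijective K ℝ).injective <|
    WeakDual.CharacterSpace.ext fun f => DFunLike.congr_fun h f

theorem norm_associatedMap_le {X : Type*} [NormedAddCommGroup X] [NormedSpace ℝ X]
    (T : X →L[ℝ] C(S, ℝ)) (s : S) : ‖associatedMap T s‖ ≤ ‖T‖ :=
  ((diracFunctional s).opNorm_comp_le T).trans_eq (by rw [norm_diracFunctional, one_mul])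

theorem apply_eq_zero_of_forall_mul_eq_zero {𝕜 F : Type*} [RCLike 𝕜] [T2Space S]
    [NormedAddCommGroup F] [NormedSpace 𝕜 F] {φ : C(S, 𝕜) →L[𝕜] F} {q : C(S, 𝕜)}
    (hφ : ∀ w, φ (w * q) = 0) {v : C(S, 𝕜)} (hv : ∀ s, q s = 0 → v s = 0) : φ v = 0 := by
  have hvq : v ∈ (Ideal.span {q}).closure := by
    rw [← ContinuousMap.idealOfSet_ofIdeal_eq_closure, ContinuousMap.mem_idealOfSet]
    intro s hs
    exact hv s (ContinuousMap.notMem_setOfIdeal.1 hs (Ideal.mem_span_singleton_self q))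
  have hker : closure (Ideal.span {q} : Set C(S, 𝕜)) ⊆ {u | φ u = 0} := by
    refine closure_minimal (fun u hu => ?_) (isClosed_eq φ.continuous continuous_const)
    obtain ⟨w, rfl⟩ := Ideal.mem_span_singleton'.1 hu
    exact hφ w
  exact hker hvq

namespace IsLinearExtensionOperator

variable {h : K → S} {E : C(K, ℝ) →L[ℝ] C(S, ℝ)}

theorem apply_apply (hE : IsLinearExtensionOperator h E) (f : C(K, ℝ)) (k : K) :
    E f (h k) = f k :=
  DFunLike.congr_fun (congrFun hE k) f

theorem injective [T2Space K] (hE : IsLinearExtensionOperator h E) : Function.Injective h :=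
  .of_comp (f := associatedMap E) (hE ▸ diracFunctional_injective)

theorem one_le_norm [Nonempty K] (hE : IsLinearExtensionOperator h E) : 1 ≤ ‖E‖ := by
  obtain ⟨k⟩ := ‹Nonempty K›
  rw [← norm_diracFunctional k, ← congrFun hE k]
  exact norm_associatedMap_le E (h k)

theorem leftInverse_compCLM {h : C(K, S)} (hE : IsLinearExtensionOperator h E) :
    Function.LeftInverse (ContinuousMap.compCLM ℝ ℝ h) E :=
  fun f => ContinuousMap.ext (hE.apply_apply f)

end IsLinearExtensionOperator

end ContinuousFunctions

section Peak

variable {K : Type*} [TopologicalSpace K] [CompactSpace K] {k : K}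

/-- `f` attains its norm, with positive sign, at `k`. Such functions play the role of the peak
functions in Holsztyński's argument; they form a cone, which is why `‖f‖ = 1` is not imposed. -/
def PeaksAt (f : C(K, ℝ)) (k : K) : Prop :=
  ‖f‖ = f k

theorem peaksAt_of_abs_le {f : C(K, ℝ)} (hf : ∀ x, |f x| ≤ f k) : PeaksAt f k :=
  le_antisymm ((f.norm_le ((abs_nonneg _).trans (hf k))).2 hf) (f.apply_le_norm k)

theorem peaksAt_one : PeaksAt 1 k :=
  peaksAt_of_abs_le fun x => by simp

theorem PeaksAt.sum {ι : Type*} {u : Finset ι} {f : ι → C(K, ℝ)}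
    (hf : ∀ i ∈ u, PeaksAt (f i) k) : PeaksAt (∑ i ∈ u, f i) k := by
  refine le_antisymm ?_ (ContinuousMap.apply_le_norm _ k)
  calc ‖∑ i ∈ u, f i‖ ≤ ∑ i ∈ u, ‖f i‖ := norm_sum_le u f
    _ = (∑ i ∈ u, f i) k := by rw [ContinuousMap.sum_apply, Finset.sum_congr rfl hf]

theorem exists_peaksAt_sub_eq (g : C(K, ℝ)) (k : K) :
    ∃ p q : C(K, ℝ), PeaksAt p k ∧ PeaksAt q k ∧ p - q = g := by
  let w : C(K, ℝ) := g - .const K (g k)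
  -- `|w| ≤ 2 * ‖g‖`, and the third `‖g‖` absorbs `g` itself.
  let q : C(K, ℝ) := .const K (3 * ‖g‖) - |w|
  have hg : ∀ x, |g x| ≤ ‖g‖ := g.norm_coe_le_norm
  refine ⟨g + q, q, peaksAt_of_abs_le fun x => ?_, peaksAt_of_abs_le fun x => ?_,
    add_sub_cancel_right g q⟩ <;>
  · simp only [q, w, ContinuousMap.add_apply, ContinuousMap.sub_apply, ContinuousMap.const_apply,
      ContinuousMap.abs_apply, sub_self, abs_zero, sub_zero]
    grind

end Peak

section Holsztynski

theorem forall_eq_or_forall_eq_neg_of_sum_le_abs_sum {ι R : Type*} [AddCommGroup R] [LinearOrder R]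
    [IsOrderedAddMonoid R] {u : Finset ι} {a b : ι → R} (hab : ∀ i ∈ u, |a i| ≤ b i)
    (hsum : ∑ i ∈ u, b i ≤ |∑ i ∈ u, a i|) :
    (∀ i ∈ u, a i = b i) ∨ ∀ i ∈ u, a i = -b i := by
  have hle : ∀ i ∈ u, a i ≤ b i := fun i hi => (le_abs_self _).trans (hab i hi)
  have hneg_le : ∀ i ∈ u, -a i ≤ b i := fun i hi => (neg_le_abs _).trans (hab i hi)
  rcases abs_choice (∑ i ∈ u, a i) with h | h <;> rw [h] at hsum
  · exact .inl ((Finset.sum_eq_sum_iff_of_le hle).1 ((Finset.sum_le_sum hle).antisymm hsum))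
  · rw [← Finset.sum_neg_distrib] at hsum
    refine .inr fun i hi => neg_eq_iff_eq_neg.1 ?_
    exact (Finset.sum_eq_sum_iff_of_le hneg_le).1 ((Finset.sum_le_sum hneg_le).antisymm hsum) i hi

variable {K S : Type*} [TopologicalSpace K] [CompactSpace K] [TopologicalSpace S] [CompactSpace S]

theorem exists_forall_apply_eq_or_eq_neg [Nonempty S] (T : C(K, ℝ) →ₗᵢ[ℝ] C(S, ℝ)) {k : K}
    {ι : Type*} {u : Finset ι} {f : ι → C(K, ℝ)} (hf : ∀ i ∈ u, PeaksAt (f i) k) :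
    ∃ s, (∀ i ∈ u, T (f i) s = f i k) ∨ ∀ i ∈ u, T (f i) s = -f i k := by
  obtain ⟨s, hs⟩ := exists_norm_le_norm_apply (T (∑ i ∈ u, f i))
  refine ⟨s, forall_eq_or_forall_eq_neg_of_sum_le_abs_sum (fun i hi => ?_) ?_⟩
  · rw [← hf i hi, ← T.norm_map]
    exact (T (f i)).norm_coe_le_norm s
  · rwa [T.norm_map, PeaksAt.sum hf, map_sum, ContinuousMap.sum_apply,
      ContinuousMap.sum_apply] at hs

/-- The operator `f ↦ T 1 * T f`. At a point `s` where `associatedMap T s = ± δ_k` the factor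
`T 1 s` is that sign, so the sign-corrected operator has associated functional `δ_k` there. -/
noncomputable def signCorrection (T : C(K, ℝ) →ₗᵢ[ℝ] C(S, ℝ)) : C(K, ℝ) →L[ℝ] C(S, ℝ) :=
  (ContinuousLinearMap.mul ℝ C(S, ℝ) (T 1)).comp T.toContinuousLinearMap

theorem signCorrection_apply_apply (T : C(K, ℝ) →ₗᵢ[ℝ] C(S, ℝ)) (f : C(K, ℝ)) (s : S) :
    signCorrection T f s = T 1 s * T f s :=
  rfl

theorem norm_mul_apply_one_le (T : C(K, ℝ) →ₗᵢ[ℝ] C(S, ℝ)) :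
    ‖ContinuousLinearMap.mul ℝ C(S, ℝ) (T 1)‖ ≤ 1 :=
  (ContinuousLinearMap.opNorm_mul_apply_le ℝ _ _).trans <|
    (T.norm_map 1).trans_le ((ContinuousMap.norm_le _ zero_le_one).2 fun k => by simp)

theorem norm_signCorrection_le (T : C(K, ℝ) →ₗᵢ[ℝ] C(S, ℝ)) : ‖signCorrection T‖ ≤ 1 :=
  (ContinuousLinearMap.opNorm_comp_le _ _).trans <|
    mul_le_one₀ (norm_mul_apply_one_le T) (norm_nonneg _) T.norm_toContinuousLinearMap_le

theorem exists_associatedMap_signCorrection_eq (T : C(K, ℝ) →ₗᵢ[ℝ] C(S, ℝ)) (k : K) :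
    ∃ s, associatedMap (signCorrection T) s = diracFunctional k := by
  classical
  have : Nonempty K := ⟨k⟩
  have : Nonempty S := not_isEmpty_iff.1 fun _ =>
    one_ne_zero (T.injective (Subsingleton.elim (T 1) (T 0)))
  have hinter :
      (⋂ f : {f : C(K, ℝ) // PeaksAt f k}, {s | signCorrection T f s = f.1 k}).Nonempty := by
    refine CompactSpace.iInter_nonempty
      (fun f => isClosed_eq (map_continuous _) continuous_const) fun u => ?_
    obtain ⟨s, hs⟩ := exists_forall_apply_eq_or_eq_neg T (u := insert ⟨1, peaksAt_one⟩ u)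
      fun f _ => f.2
    refine ⟨s, Set.mem_iInter₂.2 fun f hf => ?_⟩
    rcases hs with hs | hs <;>
    · have h1 := hs _ (Finset.mem_insert_self _ _)
      have hf := hs f (Finset.mem_insert_of_mem hf)
      simp [signCorrection_apply_apply, h1, hf]
  obtain ⟨s, hs⟩ := hinter
  have hpeak : ∀ f, PeaksAt f k → signCorrection T f s = f k := fun f hf =>
    Set.mem_iInter.1 hs ⟨f, hf⟩
  refine ⟨s, ContinuousLinearMap.ext fun g => ?_⟩
  obtain ⟨p, q, hp, hq, rfl⟩ := exists_peaksAt_sub_eq g k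
  rw [map_sub, map_sub]
  exact congrArg₂ _ (hpeak p hp) (hpeak q hq)

end Holsztynski

section UEmbedding

variable {K S : Type*} [TopologicalSpace K] [CompactSpace K] [TopologicalSpace S] [CompactSpace S]
  {T : C(K, ℝ) →ₗᵢ[ℝ] C(S, ℝ)}

theorem abs_apply_one_of_associatedMap_eq {s : S} {k : K}
    (hs : associatedMap (signCorrection T) s = diracFunctional k) : |T 1 s| = 1 := by
  have hsq : T 1 s * T 1 s = 1 := DFunLike.congr_fun hs 1
  rcases mul_self_eq_one_iff.1 hsq with h | h <;> simp [h]

theorem isHahnBanachExtension_smul_diracFunctional {s : S} {k : K}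
    (hs : associatedMap (signCorrection T) s = diracFunctional k) :
    IsHahnBanachExtension T (diracFunctional k) (T 1 s • diracFunctional s) := by
  refine isHahnBanachExtension_of_norm_le (DFunLike.congr_fun hs) ?_
  rw [norm_smul, Real.norm_eq_abs, abs_apply_one_of_associatedMap_eq hs, norm_diracFunctional,
    norm_diracFunctional, one_mul]

namespace IsUEmbedding

theorem eq_of_associatedMap_eq [T2Space S] (hT : IsUEmbedding T) {k : K} {s t : S}
    (hs : associatedMap (signCorrection T) s = diracFunctional k)
    (ht : associatedMap (signCorrection T) t = diracFunctional k) : s = t := by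
  have heq : T 1 s • diracFunctional s = T 1 t • diracFunctional t :=
    (hT _ (norm_diracFunctional k)).unique (isHahnBanachExtension_smul_diracFunctional hs)
      (isHahnBanachExtension_smul_diracFunctional ht)
  have hsign : T 1 s = T 1 t := by
    simpa [diracFunctional] using DFunLike.congr_fun heq 1
  have hne : T 1 t ≠ 0 := abs_ne_zero.1 (by simp [abs_apply_one_of_associatedMap_eq ht])
  rw [hsign] at heq
  exact diracFunctional_injective (smul_right_injective _ hne heq)

theorem continuous_of_isLinearExtensionOperator [T2Space S] (hT : IsUEmbedding T) {h : K → S}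
    (hh : IsLinearExtensionOperator h (signCorrection T)) : Continuous h := by
  refine continuous_of_isClosed_graph ?_
  have hgraph : {p : K × S | p.2 = h p.1} = {p | ∀ f, signCorrection T f p.2 = f p.1} := by
    ext ⟨k, s⟩
    refine ⟨?_, fun hs => hT.eq_of_associatedMap_eq (ContinuousLinearMap.ext hs) (congrFun hh k)⟩
    rintro (rfl : s = h k) f
    exact hh.apply_apply f k
  rw [hgraph, Set.ofPred_forall]
  exact isClosed_iInter fun f => isClosed_eq (by fun_prop) (by fun_prop)

theorem range_eq_one_le_norm_associatedMap [T2Space S] (hT : IsUEmbedding T) {h : C(K, S)}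
    (hh : IsLinearExtensionOperator h (signCorrection T)) :
    Set.range h = {s | 1 ≤ ‖associatedMap T.toContinuousLinearMap s‖} := by
  refine Set.Subset.antisymm ?_ fun s hs => ?_
  · rintro _ ⟨k, rfl⟩
    have : Nonempty K := ⟨k⟩
    exact (abs_apply_one_of_associatedMap_eq (congrFun hh k)).symm.trans_le
      ((associatedMap T.toContinuousLinearMap (h k)).unit_le_opNorm 1 norm_one.le)
  have hnorm : ‖associatedMap T.toContinuousLinearMap s‖ = 1 :=
    ((norm_associatedMap_le _ s).trans T.norm_toContinuousLinearMap_le).antisymm hs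
  let R : C(S, ℝ) →L[ℝ] C(K, ℝ) :=
    (ContinuousMap.compCLM ℝ ℝ h).comp (ContinuousLinearMap.mul ℝ C(S, ℝ) (T 1))
  have hR : ‖R‖ ≤ 1 := (ContinuousLinearMap.opNorm_comp_le _ _).trans <|
    mul_le_one₀ (norm_compCLM_le h) (norm_nonneg _) (norm_mul_apply_one_le T)
  have hδ : diracFunctional s = (associatedMap T.toContinuousLinearMap s).comp R :=
    hT.eq_comp_of_leftInverse hR hh.leftInverse_compCLM hnorm
      ⟨rfl, (norm_diracFunctional s).trans hnorm.symm⟩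
  refine mem_of_forall_continuousMap_eq_zero (isCompact_range h.continuous).isClosed fun u hu => ?_
  have hRu : R u = 0 := ContinuousMap.ext fun k => by
    simp [R, hu _ (Set.mem_range_self k)]
  calc u s = associatedMap T.toContinuousLinearMap s (R u) := DFunLike.congr_fun hδ u
    _ = 0 := by rw [hRu, map_zero]

theorem isGδ_range [T2Space S] (hT : IsUEmbedding T) {h : C(K, S)}
    (hh : IsLinearExtensionOperator h (signCorrection T)) : IsGδ (Set.range h) := by
  rw [hT.range_eq_one_le_norm_associatedMap hh]
  exact isGδ_le_of_lowerSemicontinuous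
    (lowerSemicontinuous_opNorm fun f => map_continuous (T f)) 1

end IsUEmbedding

theorem IsHahnBanachExtension.apply_mul_one_sub_eq_zero {X : Type*} [NormedAddCommGroup X]
    [NormedSpace ℝ X] {T : X →ₗᵢ[ℝ] C(S, ℝ)} {x' : StrongDual ℝ X} {y' : StrongDual ℝ C(S, ℝ)}
    (hy' : IsHahnBanachExtension T x' y') {g : C(S, ℝ)} (hg1 : ∀ s, g s ≤ 1)
    (hTg : ∀ x, ‖x‖ ≤ 1 → ∀ s, |T x s| ≤ g s) (w : C(S, ℝ)) : y' (w * (1 - g)) = 0 := by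
  let φ : StrongDual ℝ C(S, ℝ) := y'.comp ((ContinuousLinearMap.mul ℝ C(S, ℝ)).flip (1 - g))
  suffices hφ : φ = 0 from DFunLike.congr_fun hφ w
  refine (norm_le_zero_iff (a := φ)).1 <|
    φ.opNorm_le_of_unit_norm le_rfl fun w hw => norm_le_zero_iff.2 ?_
  refine hy'.apply_eq_zero_of_norm_add_le fun x hx => ?_
  refine (ContinuousMap.norm_le _ zero_le_one).2 fun s => ?_
  have hg : 0 ≤ 1 - g s := sub_nonneg.2 (hg1 s)
  have hws : |w s| ≤ 1 := (w.norm_coe_le_norm s).trans_eq hw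
  calc |T x s + w s * (1 - g s)| ≤ |T x s| + |w s| * (1 - g s) := by
        rw [← abs_of_nonneg hg, ← abs_mul, abs_of_nonneg hg]
        exact abs_add_le _ _
    _ ≤ g s + 1 * (1 - g s) := by gcongr; exact hTg x hx s
    _ = 1 := by ring

theorem exists_isUEmbedding_of_isLinearExtensionOperator [T2Space S] {h : C(K, S)}
    (hG : IsGδ (Set.range h)) {E : C(K, ℝ) →L[ℝ] C(S, ℝ)} (hE : IsLinearExtensionOperator h E)
    (hE1 : ‖E‖ ≤ 1) : ∃ T : C(K, ℝ) →ₗᵢ[ℝ] C(S, ℝ), IsUEmbedding T := by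
  obtain ⟨g, hrange, -, -, hg01⟩ := exists_continuous_one_zero_of_isCompact_of_isGδ
    (isCompact_range h.continuous) hG isClosed_empty (Set.disjoint_empty _)
  have hgE : IsLinearExtensionOperator h ((ContinuousLinearMap.mul ℝ C(S, ℝ) g).comp E) := by
    ext k f
    have hgk : g (h k) = 1 := hrange.subset (Set.mem_range_self k)
    change g (h k) * E f (h k) = f k
    rw [hgk, one_mul, hE.apply_apply]
  have hgE_le : ∀ f, ‖f‖ ≤ 1 → ∀ s, |(g * E f) s| ≤ g s := fun f hf s => by
    have hEf : |E f s| ≤ 1 := ((E f).norm_coe_le_norm s).trans <| by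
      simpa using E.le_of_opNorm_le_of_le hE1 hf
    rw [ContinuousMap.mul_apply, abs_mul, abs_of_nonneg (hg01 s).1]
    exact mul_le_of_le_one_right (hg01 s).1 hEf
  have hg_norm : ‖g‖ ≤ 1 := (g.norm_le zero_le_one).2 fun s =>
    (abs_of_nonneg (hg01 s).1).trans_le (hg01 s).2
  have hgE1 : ‖(ContinuousLinearMap.mul ℝ C(S, ℝ) g).comp E‖ ≤ 1 :=
    (ContinuousLinearMap.opNorm_comp_le _ _).trans <|
      mul_le_one₀ ((ContinuousLinearMap.opNorm_mul_apply_le ℝ _ _).trans hg_norm)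
        (norm_nonneg _) hE1
  let T := isometryOfLeftInverse _ _ hgE1 (norm_compCLM_le h) hgE.leftInverse_compCLM
  refine ⟨T, isUEmbedding_of_leftInverse (norm_compCLM_le h) hgE.leftInverse_compCLM
    fun x' y' hy' v hv => ?_⟩
  refine apply_eq_zero_of_forall_mul_eq_zero
    (hy'.apply_mul_one_sub_eq_zero (fun s => (hg01 s).2) hgE_le) fun s hs => ?_
  obtain ⟨k, rfl⟩ := hrange.superset (sub_eq_zero.1 hs).symm
  exact DFunLike.congr_fun hv k

end UEmbedding

theorem mainTheorem2 {K S : Type*} [TopologicalSpace K] [CompactSpace K] [T2Space K] [Nonempty K]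
    [TopologicalSpace S] [CompactSpace S] [T2Space S] :
    (∃ T : C(K, ℝ) →ₗᵢ[ℝ] C(S, ℝ), IsUEmbedding T) ↔
      ∃ h : K → S, IsEmbedding h ∧ IsGδ (Set.range h) ∧
        ∃ T : C(K, ℝ) →L[ℝ] C(S, ℝ), IsLinearExtensionOperator h T ∧ ‖T‖ = 1 := by
  constructor
  · rintro ⟨T, hT⟩
    choose h hh using exists_associatedMap_signCorrection_eq T
    have hext : IsLinearExtensionOperator h (signCorrection T) := funext hh
    have hcont : Continuous h := hT.continuous_of_isLinearExtensionOperator hext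
    exact ⟨h, (hcont.isClosedEmbedding hext.injective).isEmbedding,
      hT.isGδ_range (h := ⟨h, hcont⟩) hext, signCorrection T, hext,
      (norm_signCorrection_le T).antisymm hext.one_le_norm⟩
  · rintro ⟨h, hh, hG, E, hE, hE1⟩
    exact exists_isUEmbedding_of_isLinearExtensionOperator (h := ⟨h, hh.continuous⟩) hG hE hE1.le
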